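/- Let $\alpha,\beta>0$, let $X\sim\mathrm{Beta}(\alpha,\beta)$, and let ${}_1F_1(a;b;x)=\sum_{j\ge 0}\frac{(a)_j}{(b)_j\,j!}x^j$, where $(a)_j=a(a+1)\cdots(a+j-1)$. A number $s\ge 0$ is called a proxy variance of $X$ (and $X$ is called $s$-sub-Gaussian) if $\mathbb{E}[\exp(\lambda(X-\mathbb{E}X))]\le \exp(\lambda^2 s/2)$ for all $\lambda\in\mathbb{R}$; the optimal proxy variance $\sigma^2_{\mathrm{opt}}(\alpha,\beta)$ is the infimum of the proxy variances of $X$. Then this infimum is a minimum, i.e. $\mathrm{Beta}(\alpha,\beta)$ is $\sigma^2_{\mathrm{opt}}(\alpha,\beta)$-sub-Gaussian. Consider the equation $$\ln\big({}_1F_1(\alpha;\alpha+\beta;x)\big)=\frac{\alpha x}{2(\alpha+\beta)}\left(1+\frac{{}_1F_1(\alpha+1;\alpha+\beta+1;x)}{{}_1F_1(\alpha;\alpha+\beta;x)}\right),\qquad x\in\mathbb{R}, \tag{E}$$ and, for $x\ne 0$, the expression $$V(x)=\frac{\alpha}{(\alpha+\beta)x}\left(\frac{{}_1F_1(\alpha+1;\alpha+\beta+1;x)}{{}_1F_1(\alpha;\alpha+\beta;x)}-1\right).$$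 (i) If $\alpha\neq\beta$, then (E) has exactly one nonzero real solution $x_0$, and $\sigma^2_{\mathrm{opt}}(\alpha,\beta)=V(x_0)$. If $\alpha=\beta$, then $x=0$ is the only real solution of (E), and $\sigma^2_{\mathrm{opt}}(\alpha,\alpha)=\lim_{x\to 0,\,x\neq 0}V(x)$. (ii) If $\alpha\ne\beta$, then $\mathrm{Var}[\mathrm{Beta}(\alpha,\beta)]<\sigma^2_{\mathrm{opt}}(\alpha,\beta)<\frac{1}{4(\alpha+\beta+1)}$. (iii) If $\alpha=\beta$, then $\mathrm{Var}[\mathrm{Beta}(\alpha,\alpha)]=\sigma^2_{\mathrm{opt}}(\alpha,\alpha)=\frac{1}{4(2\alpha+1)}$. -/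

import Mathlib

open MeasureTheory ProbabilityTheory Filter Topology

namespace BetaProxy

/-- Kummer's confluent hypergeometric function
`₁F₁(a; b; x) = ∑ j, (a)_j / ((b)_j j!) x ^ j`, where `(a)_j = a (a + 1) ⋯ (a + j - 1)`. -/
noncomputable def kummer (a b x : ℝ) : ℝ :=
  ∑' j : ℕ, (ascPochhammer ℝ j).eval a / ((ascPochhammer ℝ j).eval b * (j.factorial : ℝ)) * x ^ j

/-- The series defining `kummer` converges at every real point (so that the sum is never a
junk value for positive parameters). -/
theorem summable_kummer {a b : ℝ} (ha : 0 < a) (hb : 0 < b) (x : ℝ) :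
    Summable fun j : ℕ =>
      (ascPochhammer ℝ j).eval a / ((ascPochhammer ℝ j).eval b * (j.factorial : ℝ)) * x ^ j := by
  rcases eq_or_ne x 0 with rfl | hx
  · refine summable_of_ne_finset_zero (s := {0}) ?_
    intro j hj
    simp only [Finset.mem_singleton] at hj
    simp [hj]
  have hA : ∀ j : ℕ, 0 < (ascPochhammer ℝ j).eval a := fun j => ascPochhammer_pos j a ha
  have hB : ∀ j : ℕ, 0 < (ascPochhammer ℝ j).eval b := fun j => ascPochhammer_pos j b hb
  refine summable_of_ratio_test_tendsto_lt_one (l := 0) zero_lt_one ?_ ?_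
  · refine Eventually.of_forall fun j => ?_
    have h1 := (hA j).ne'
    have h2 := (hB j).ne'
    have h3 : (j.factorial : ℝ) ≠ 0 := by positivity
    positivity
  · have hlim : Tendsto (fun j : ℕ => (|x| * (1 + a / b)) / ((j : ℝ) + 1)) atTop (𝓝 0) :=
      tendsto_const_nhds.div_atTop
        (tendsto_atTop_add_const_right _ _ tendsto_natCast_atTop_atTop)
    refine squeeze_zero (fun j => by positivity) (fun j => ?_) hlim
    have h1 := hA j
    have h2 := hB j
    have h3 : (0 : ℝ) < (j.factorial : ℝ) := by positivity
    have hbj : 0 < b + (j : ℝ) := by positivity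
    have haj : 0 < a + (j : ℝ) := by positivity
    have hx' : 0 < |x| := abs_pos.mpr hx
    have key : (a + j) / (b + j) ≤ 1 + a / b := by
      rw [div_le_iff₀ hbj]
      have : 0 ≤ a / b * j := by positivity
      have h : a / b * b = a := by field_simp
      nlinarith
    simp only [Real.norm_eq_abs, abs_mul, abs_div, abs_pow, ascPochhammer_succ_eval,
      Nat.factorial_succ, Nat.cast_mul, Nat.cast_succ]
    rw [abs_of_pos h1, abs_of_pos h2, abs_of_pos h3, abs_of_pos hbj, abs_of_pos haj,
      abs_of_pos (by positivity : (0 : ℝ) < (j : ℝ) + 1)]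
    have e : (ascPochhammer ℝ j).eval a * (a + j) /
          ((ascPochhammer ℝ j).eval b * (b + j) * (((j : ℝ) + 1) * (j.factorial : ℝ)))
          * |x| ^ (j + 1) /
        ((ascPochhammer ℝ j).eval a / ((ascPochhammer ℝ j).eval b * (j.factorial : ℝ)) * |x| ^ j)
        = |x| * ((a + j) / (b + j)) / ((j : ℝ) + 1) := by
      field_simp
      ring
    rw [e]
    gcongr

/-- `s` is a proxy variance of the random variable `X`: `X` has a finite mean, and
`𝔼[exp (t (X - 𝔼[X]))] ≤ exp (s t² / 2)` for all real `t` (where the left-hand expectation is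
required to be finite), i.e. `X` is `s`-sub-Gaussian. -/
def IsSubGaussian {Ω : Type*} [MeasurableSpace Ω] (X : Ω → ℝ) (P : Measure Ω)
    (s : NNReal) : Prop :=
  Integrable X P ∧ HasSubgaussianMGF (fun ω => X ω - ∫ ω', X ω' ∂P) s P

/-- The optimal proxy variance of `X`: the infimum of the proxy variances. -/
noncomputable def optimalProxyVariance {Ω : Type*} [MeasurableSpace Ω] (X : Ω → ℝ)
    (P : Measure Ω) : NNReal :=
  sInf {s : NNReal | IsSubGaussian X P s}

/-- The transcendental equation for `x`:
`ln ₁F₁(α; α+β; x) = αx / (2(α+β)) (1 + ₁F₁(α+1; α+β+1; x) / ₁F₁(α; α+β; x))`. -/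
def KummerEquation (α β x : ℝ) : Prop :=
  Real.log (kummer α (α + β) x) =
    α * x / (2 * (α + β)) * (1 + kummer (α + 1) (α + β + 1) x / kummer α (α + β) x)

/-- The expression
`α / ((α+β) x) (₁F₁(α+1; α+β+1; x) / ₁F₁(α; α+β; x) - 1)`. -/
noncomputable def kummerVariance (α β x : ℝ) : ℝ :=
  α / ((α + β) * x) * (kummer (α + 1) (α + β + 1) x / kummer α (α + β) x - 1)

end BetaProxy

/-!
For `X ∼ Beta(α, β)` let `μ = α / (α + β)` be the mean, `M` the moment generating function,
`h(t) = log M(t) - μ t` the centred cumulant generating function and `m = M' / M` the tilted mean,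
so that `h' = m - μ`. A number `s` is a proxy variance exactly when `h(t) ≤ s t² / 2` for all `t`, so
the optimal proxy variance is the supremum of `g(t) = 2 h(t) / t²` (`isSubGaussian_iff`). The moments
of `X` are quotients of rising factorials, hence `M(t) = ₁F₁(α; α + β; t)` and
`M'(t) = μ ₁F₁(α + 1; α + β + 1; t)`. With the defect `D(t) = t h'(t) - 2 h(t)` one has
`g'(t) = 2 D(t) / t³`, and the transcendental equation of the theorem says `D = 0`
(`kummerEquation_iff`); at such a point `g` equals the slope `v(t) = (m(t) - μ) / t`, which is
`kummerVariance`.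

Everything rests on the sign of `N = D' = t m' - (m - μ) = t² v'`. Kummer's differential equation for
`M` becomes the Riccati equation `t m' = t m (1 - m) - (α + β) (m - μ)`, whence
`N = t m (1 - m) - (α + β + 1) (m - μ)` and, for `t > 0`,
`(t ^ (α + β) M² exp(-t) N)' = t ^ (α + β) M² exp(-t) (m - μ) (1 - 2 m)`
(`hasDerivAt_weightedSlopeDefect`). As `m` is strictly increasing, the right-hand side is positive
until `m` reaches `1 / 2` and negative afterwards.

* If `α ≥ β`, then `m > 1 / 2` on `t > 0`, so `N < 0` and `D < 0` there, and `v` decreases from its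
  value `v(0) = Var X`: positive `t` only require the variance.
* If `α < β`, then `N` changes sign exactly once on `t > 0`, at some `t₁`, from plus to minus
  (`exists_slopeDefect_sign_change`; `N` cannot stay positive because `D` is eventually negative).
  So `D` increases from `0`, then decreases, and has exactly one positive zero `x₀ > t₁`, the maximum
  of `g` on `t > 0` (`exists_pos_maximizer`). The slope `v` increases up to `t₁` and decreases
  afterwards, so `g(x₀) ≥ g(t₁) > v(0) = Var X`, and, since `N(t₁) = 0`,
  `g(x₀) = v(x₀) < v(t₁) = m(t₁) (1 - m(t₁)) / (α + β + 1) ≤ 1 / (4 (α + β + 1))`.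

Negative `t` are handled by the reflection `X ↦ 1 - X`, which exchanges `α` and `β` and replaces `t`
by `-t`.
-/

namespace BetaProxy

/-! ### Integration against the beta distribution -/

variable {α β : ℝ}

theorem beta_add_one_left (hα : 0 < α) (hβ : 0 < β) :
    beta (α + 1) β = α / (α + β) * beta α β := by
  have h : α + β ≠ 0 := by positivity
  have hG := (Real.Gamma_pos_of_pos (add_pos hα hβ)).ne'
  rw [beta, beta, add_right_comm, Real.Gamma_add_one hα.ne', Real.Gamma_add_one h]
  field_simp

theorem beta_symm (α β : ℝ) : beta β α = beta α β := by
  rw [beta, beta, add_comm, mul_comm]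

theorem betaPDFReal_nonneg (hα : 0 < α) (hβ : 0 < β) (x : ℝ) : 0 ≤ betaPDFReal α β x := by
  by_cases hx : 0 < x ∧ x < 1
  · exact (betaPDFReal_pos hx.1 hx.2 hα hβ).le
  · simp [betaPDFReal, hx]

theorem betaPDFReal_mul_self (hα : 0 < α) (hβ : 0 < β) (x : ℝ) :
    betaPDFReal α β x * x = α / (α + β) * betaPDFReal (α + 1) β x := by
  by_cases hx : 0 < x ∧ x < 1
  · have hB := (beta_pos hα hβ).ne'
    have hs : α + β ≠ 0 := by positivity
    rw [betaPDFReal, betaPDFReal, if_pos hx, if_pos hx, beta_add_one_left hα hβ,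
      add_sub_right_comm, Real.rpow_add_one hx.1.ne']
    field_simp
  · simp [betaPDFReal, hx]

theorem betaPDFReal_one_sub (α β x : ℝ) : betaPDFReal α β (1 - x) = betaPDFReal β α x := by
  have h : (0 < 1 - x ∧ 1 - x < 1) ↔ (0 < x ∧ x < 1) := by
    constructor <;> rintro ⟨h1, h2⟩ <;> constructor <;> linarith
  simp only [betaPDFReal, h, sub_sub_cancel, beta_symm]
  split_ifs
  · ring
  · rfl

theorem integral_betaMeasure (hα : 0 < α) (hβ : 0 < β) (f : ℝ → ℝ) :
    ∫ x, f x ∂betaMeasure α β = ∫ x, betaPDFReal α β x * f x := by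
  unfold betaMeasure betaPDF
  rw [integral_withDensity_eq_integral_toReal_smul (by fun_prop) (by simp)]
  simp only [ENNReal.toReal_ofReal (betaPDFReal_nonneg hα hβ _), smul_eq_mul]

/-- Size-biasing a beta variable raises its first parameter by one. -/
theorem integral_id_mul_betaMeasure (hα : 0 < α) (hβ : 0 < β) (f : ℝ → ℝ) :
    ∫ x, x * f x ∂betaMeasure α β = α / (α + β) * ∫ x, f x ∂betaMeasure (α + 1) β := by
  rw [integral_betaMeasure hα hβ, integral_betaMeasure (by positivity) hβ, ← integral_const_mul]
  simp only [← mul_assoc, betaPDFReal_mul_self hα hβ]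

theorem integral_one_sub_betaMeasure (hα : 0 < α) (hβ : 0 < β) (f : ℝ → ℝ) :
    ∫ x, f (1 - x) ∂betaMeasure α β = ∫ x, f x ∂betaMeasure β α := by
  rw [integral_betaMeasure hα hβ, integral_betaMeasure hβ hα,
    ← integral_sub_left_eq_self (fun x => betaPDFReal β α x * f x) volume 1]
  simp only [betaPDFReal_one_sub]

theorem ae_mem_Ioo_betaMeasure (α β : ℝ) : ∀ᵐ x ∂betaMeasure α β, x ∈ Set.Ioo (0 : ℝ) 1 := by
  rw [betaMeasure, ae_withDensity_iff' (by unfold betaPDF; fun_prop)]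
  refine Eventually.of_forall fun x hx => ?_
  by_contra h
  have h' : ¬(0 < x ∧ x < 1) := h
  exact hx (by rw [betaPDF_eq, if_neg h', ENNReal.ofReal_zero])

theorem ae_mem_Icc_betaMeasure (α β : ℝ) : ∀ᵐ x ∂betaMeasure α β, x ∈ Set.Icc (0 : ℝ) 1 := by
  filter_upwards [ae_mem_Ioo_betaMeasure α β] with x hx using Set.Ioo_subset_Icc_self hx

theorem betaMeasure_Ici_pos (hα : 0 < α) (hβ : 0 < β) {a : ℝ} (ha0 : 0 ≤ a) (ha : a < 1) :
    0 < (betaMeasure α β).real (Set.Ici a) := by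
  have := isProbabilityMeasureBeta hα hβ
  rw [measureReal_def, ENNReal.toReal_pos_iff]
  refine ⟨?_, measure_lt_top _ _⟩
  rw [betaMeasure, withDensity_apply _ measurableSet_Ici]
  refine lt_of_lt_of_le ?_ (lintegral_mono_set (s := Set.Ioo a 1) fun x hx => hx.1.le)
  rw [setLIntegral_pos_iff (by unfold betaPDF; fun_prop)]
  refine lt_of_lt_of_le (b := volume (Set.Ioo a 1)) (by simp [ha]) (measure_mono fun x hx => ?_)
  refine ⟨?_, hx⟩
  rw [Function.mem_support, betaPDF]
  simpa using betaPDFReal_pos (ha0.trans_lt hx.1) hx.2 hα hβ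

/-! ### Exponential moments and Kummer's function -/

/-- The exponential moment `𝔼[X ^ n * exp (t * X)]` of `X ∼ Beta(α, β)`; as a function of `t`, it
is the `n`-th derivative of the moment generating function of `X`. -/
noncomputable def expMoment (α β : ℝ) (n : ℕ) (t : ℝ) : ℝ :=
  ∫ x, x ^ n * Real.exp (t * x) ∂betaMeasure α β

theorem integrable_exp_betaMeasure (hα : 0 < α) (hβ : 0 < β) (t : ℝ) :
    Integrable (fun x : ℝ => Real.exp (t * x)) (betaMeasure α β) := by
  have := isProbabilityMeasureBeta hα hβ
  exact integrable_exp_mul_of_mem_Icc (X := fun x : ℝ => x) (by fun_prop)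
    (ae_mem_Icc_betaMeasure α β)

theorem mem_interior_integrableExpSet (hα : 0 < α) (hβ : 0 < β) (t : ℝ) :
    t ∈ interior (integrableExpSet (fun x : ℝ => x) (betaMeasure α β)) := by
  have : integrableExpSet (fun x : ℝ => x) (betaMeasure α β) = Set.univ :=
    Set.eq_univ_of_forall fun s => integrable_exp_betaMeasure hα hβ s
  simp [this]

theorem integrable_pow_mul_exp (hα : 0 < α) (hβ : 0 < β) (n : ℕ) (t : ℝ) :
    Integrable (fun x : ℝ => x ^ n * Real.exp (t * x)) (betaMeasure α β) :=
  integrable_pow_mul_exp_of_mem_interior_integrableExpSet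
    (mem_interior_integrableExpSet hα hβ t) n

theorem hasDerivAt_expMoment (hα : 0 < α) (hβ : 0 < β) (n : ℕ) (t : ℝ) :
    HasDerivAt (expMoment α β n) (expMoment α β (n + 1) t) t :=
  hasDerivAt_integral_pow_mul_exp_real (mem_interior_integrableExpSet hα hβ t) n

theorem mgf_eq_expMoment (α β t : ℝ) :
    mgf (fun x : ℝ => x) (betaMeasure α β) t = expMoment α β 0 t := by
  simp [mgf, expMoment]

theorem expMoment_zero_pos (hα : 0 < α) (hβ : 0 < β) (t : ℝ) : 0 < expMoment α β 0 t := by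
  have := isProbabilityMeasureBeta hα hβ
  rw [← mgf_eq_expMoment]
  exact mgf_pos (integrable_exp_betaMeasure hα hβ t)

theorem expMoment_zero_zero (hα : 0 < α) (hβ : 0 < β) : expMoment α β 0 0 = 1 := by
  have := isProbabilityMeasureBeta hα hβ
  simp [expMoment]

theorem expMoment_succ (hα : 0 < α) (hβ : 0 < β) (n : ℕ) (t : ℝ) :
    expMoment α β (n + 1) t = α / (α + β) * expMoment (α + 1) β n t := by
  rw [expMoment, expMoment, ← integral_id_mul_betaMeasure hα hβ]
  congr 1 with x
  ring

theorem moment_eq_ascPochhammer (hα : 0 < α) (hβ : 0 < β) (n : ℕ) :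
    expMoment α β n 0 = (ascPochhammer ℝ n).eval α / (ascPochhammer ℝ n).eval (α + β) := by
  induction n generalizing α with
  | zero => simp [expMoment_zero_zero hα hβ]
  | succ n ih =>
    have h := ascPochhammer_pos n (α + 1 + β) (by positivity)
    rw [expMoment_succ hα hβ, ih (by positivity)]
    simp only [ascPochhammer_succ_left, Polynomial.eval_mul, Polynomial.eval_X,
      Polynomial.eval_comp, Polynomial.eval_add, Polynomial.eval_one]
    rw [add_right_comm α 1 β, div_mul_div_comm]

theorem moment_recurrence (hα : 0 < α) (hβ : 0 < β) (n : ℕ) :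
    (α + β + n) * expMoment α β (n + 1) 0 = (α + n) * expMoment α β n 0 := by
  have h := ascPochhammer_pos n (α + β) (by positivity)
  rw [moment_eq_ascPochhammer hα hβ, moment_eq_ascPochhammer hα hβ, ascPochhammer_succ_eval,
    ascPochhammer_succ_eval]
  field_simp

theorem hasSum_expMoment (hα : 0 < α) (hβ : 0 < β) (n : ℕ) (t : ℝ) :
    HasSum (fun j : ℕ => expMoment α β (j + n) 0 * (t ^ j / (j.factorial : ℝ)))
      (expMoment α β n t) := by
  have := isProbabilityMeasureBeta hα hβ
  have key := hasSum_integral_of_dominated_convergence (μ := betaMeasure α β)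
    (F := fun (j : ℕ) (x : ℝ) => x ^ (j + n) * (t ^ j / (j.factorial : ℝ)))
    (f := fun x => x ^ n * Real.exp (t * x))
    (fun j _ => |t| ^ j / (j.factorial : ℝ)) (fun j => by fun_prop)
    (fun j => by
      filter_upwards [ae_mem_Icc_betaMeasure α β] with x hx
      rw [norm_mul, norm_div, norm_pow, norm_pow, Real.norm_natCast, Real.norm_eq_abs,
        Real.norm_eq_abs, abs_of_nonneg hx.1]
      exact mul_le_of_le_one_left (by positivity) (pow_le_one₀ hx.1 hx.2))
    (Eventually.of_forall fun x => Real.summable_pow_div_factorial |t|)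
    (integrable_const _)
    (Eventually.of_forall fun x => by
      have h := (NormedSpace.expSeries_div_hasSum_exp (t * x)).mul_left (x ^ n)
      rw [← Real.exp_eq_exp_ℝ] at h
      refine h.congr_fun fun j => ?_
      rw [mul_pow]
      ring)
  simpa [expMoment, integral_mul_const] using key

theorem kummer_eq_expMoment (hα : 0 < α) (hβ : 0 < β) (t : ℝ) :
    kummer α (α + β) t = expMoment α β 0 t := by
  rw [← (hasSum_expMoment hα hβ 0 t).tsum_eq, kummer]
  congr 1 with j
  rw [add_zero, moment_eq_ascPochhammer hα hβ, div_mul_eq_div_div]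
  ring

theorem kummer_add_one_eq_expMoment (hα : 0 < α) (hβ : 0 < β) (t : ℝ) :
    α / (α + β) * kummer (α + 1) (α + β + 1) t = expMoment α β 1 t := by
  rw [expMoment_succ hα hβ, ← kummer_eq_expMoment (by positivity) hβ, add_right_comm α β 1]

/-- Kummer's differential equation `t M'' + (α + β - t) M' - α M = 0` for the moment generating
function `M`: the recurrence of the moments, read off the power series. -/
theorem kummer_ode (hα : 0 < α) (hβ : 0 < β) (t : ℝ) :
    t * expMoment α β 2 t + (α + β - t) * expMoment α β 1 t - α * expMoment α β 0 t = 0 := by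
  have shift (n : ℕ) : HasSum (fun j : ℕ => j * expMoment α β (j + n) 0 *
      (t ^ j / (j.factorial : ℝ))) (t * expMoment α β (n + 1) t) := by
    rw [← hasSum_nat_add_iff' 1]
    simp only [Finset.range_one, Finset.sum_singleton, Nat.cast_zero, zero_mul, sub_zero]
    refine ((hasSum_expMoment hα hβ (n + 1) t).mul_left t).congr_fun fun j => ?_
    rw [Nat.factorial_succ, pow_succ, add_right_comm j 1 n, add_assoc j n 1]
    push_cast
    field_simp
  have h1 := ((hasSum_expMoment hα hβ 1 t).mul_left (α + β)).add (shift 1)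
  have h0 := ((hasSum_expMoment hα hβ 0 t).mul_left α).add (shift 0)
  have h := h1.unique (h0.congr_fun fun j => ?_)
  · norm_num at h
    linarith
  · have := moment_recurrence hα hβ j
    simp only [add_zero]
    linear_combination (t ^ j / (j.factorial : ℝ)) * this

theorem expMoment_one_le (hα : 0 < α) (hβ : 0 < β) (t : ℝ) :
    expMoment α β 1 t ≤ expMoment α β 0 t := by
  refine integral_mono_ae (integrable_pow_mul_exp hα hβ 1 t) (integrable_pow_mul_exp hα hβ 0 t) ?_
  filter_upwards [ae_mem_Icc_betaMeasure α β] with x hx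
  simpa using mul_le_of_le_one_left (Real.exp_pos (t * x)).le hx.2

/-- Strict log-convexity of the moment generating function. -/
theorem expMoment_one_sq_lt (hα : 0 < α) (hβ : 0 < β) (t : ℝ) :
    expMoment α β 1 t ^ 2 < expMoment α β 2 t * expMoment α β 0 t := by
  have := isProbabilityMeasureBeta hα hβ
  have h0 := expMoment_zero_pos hα hβ t
  set m := expMoment α β 1 t / expMoment α β 0 t with hm
  have i0 := integrable_pow_mul_exp hα hβ 0 t
  have i1 := integrable_pow_mul_exp hα hβ 1 t
  have i2 := integrable_pow_mul_exp hα hβ 2 t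
  have i21 : Integrable (fun x : ℝ => x ^ 2 * Real.exp (t * x) -
      2 * m * (x ^ 1 * Real.exp (t * x))) (betaMeasure α β) := i2.sub (i1.const_mul _)
  have e : (fun x : ℝ => (x - m) ^ 2 * Real.exp (t * x)) = fun x : ℝ =>
      x ^ 2 * Real.exp (t * x) - 2 * m * (x ^ 1 * Real.exp (t * x))
        + m ^ 2 * (x ^ 0 * Real.exp (t * x)) := by
    ext x; ring
  have hpos : 0 < ∫ x, (x - m) ^ 2 * Real.exp (t * x) ∂betaMeasure α β := by
    rw [integral_pos_iff_support_of_nonneg (fun x => by positivity)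
      (by rw [e]; exact i21.add (i0.const_mul _))]
    have hs : Function.support (fun x : ℝ => (x - m) ^ 2 * Real.exp (t * x)) = {m}ᶜ := by
      ext x
      simp [sub_eq_zero]
    have hnull : betaMeasure α β {m} = 0 :=
      withDensity_absolutelyContinuous volume (betaPDF α β) (by simp)
    rw [hs, prob_compl_eq_one_sub (measurableSet_singleton m), hnull]
    simp
  rw [e, integral_add i21 (i0.const_mul _),
    integral_sub i2 (i1.const_mul _), integral_const_mul, integral_const_mul] at hpos
  change 0 < expMoment α β 2 t - 2 * m * expMoment α β 1 t + m ^ 2 * expMoment α β 0 t at hpos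
  have hm' : expMoment α β 1 t = m * expMoment α β 0 t := by rw [hm]; field_simp
  rw [hm'] at hpos ⊢
  nlinarith [mul_pos hpos h0]

/-- Kummer's transformation `M_{β,α}(t) = exp t * M_{α,β}(-t)`. -/
theorem expMoment_swap (hα : 0 < α) (hβ : 0 < β) (t : ℝ) :
    expMoment β α 0 t = Real.exp t * expMoment α β 0 (-t) := by
  rw [expMoment, expMoment, ← integral_one_sub_betaMeasure hα hβ, ← integral_const_mul]
  congr 1 with x
  simp only [pow_zero, one_mul, ← Real.exp_add]
  ring_nf

end BetaProxy

namespace BetaProxy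

variable {α β : ℝ}

/-! ### The centred cumulant generating function and the tilted mean -/

/-- The centred cumulant generating function `log 𝔼[exp (t (X - 𝔼[X]))]` of `X ∼ Beta(α, β)`,
written with the explicit mean `α / (α + β)`. -/
noncomputable def centeredCgf (α β t : ℝ) : ℝ :=
  Real.log (expMoment α β 0 t) - α / (α + β) * t

/-- The mean of the exponentially tilted law of `Beta(α, β)`, whose density is proportional to
`exp (t * x)` with respect to `Beta(α, β)`. -/
noncomputable def tiltedMean (α β t : ℝ) : ℝ := expMoment α β 1 t / expMoment α β 0 t

/-- The variance `αβ / ((α + β)² (α + β + 1))` of `Beta(α, β)`. -/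
noncomputable def betaVariance (α β : ℝ) : ℝ :=
  α / (α + β) * (1 - α / (α + β)) / (α + β + 1)

/-- The defect in the equation for the critical points of `t ↦ 2 * centeredCgf α β t / t ^ 2`. It
vanishes exactly at the solutions of `KummerEquation`. -/
noncomputable def criticalDefect (α β t : ℝ) : ℝ :=
  t * (tiltedMean α β t - α / (α + β)) - 2 * centeredCgf α β t

/-- The derivative of `criticalDefect α β`, in the form given by the Riccati equation for the tilted
mean. It equals `t ^ 2` times the derivative of `tiltedSlope α β`. -/
noncomputable def slopeDefect (α β t : ℝ) : ℝ :=
  t * (tiltedMean α β t * (1 - tiltedMean α β t))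
    - (α + β + 1) * (tiltedMean α β t - α / (α + β))

/-- The difference quotient `(tiltedMean α β t - tiltedMean α β 0) / t`, extended by the derivative
at `t = 0`. -/
noncomputable def tiltedSlope (α β : ℝ) : ℝ → ℝ := dslope (tiltedMean α β) 0

theorem centeredCgf_zero (hα : 0 < α) (hβ : 0 < β) : centeredCgf α β 0 = 0 := by
  simp [centeredCgf, expMoment_zero_zero hα hβ]

theorem tiltedMean_zero (hα : 0 < α) (hβ : 0 < β) : tiltedMean α β 0 = α / (α + β) := by
  rw [tiltedMean, expMoment_succ hα hβ, expMoment_zero_zero hα hβ,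
    expMoment_zero_zero (by positivity) hβ, mul_one, div_one]

theorem criticalDefect_zero (hα : 0 < α) (hβ : 0 < β) : criticalDefect α β 0 = 0 := by
  simp [criticalDefect, centeredCgf_zero hα hβ]

theorem hasDerivAt_centeredCgf (hα : 0 < α) (hβ : 0 < β) (t : ℝ) :
    HasDerivAt (centeredCgf α β) (tiltedMean α β t - α / (α + β)) t := by
  refine (((hasDerivAt_expMoment hα hβ 0 t).log (expMoment_zero_pos hα hβ t).ne').sub
    ((hasDerivAt_id t).const_mul (α / (α + β)))).congr_deriv ?_
  rw [tiltedMean, mul_one]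

theorem hasDerivAt_tiltedMean (hα : 0 < α) (hβ : 0 < β) (t : ℝ) :
    HasDerivAt (tiltedMean α β)
      (expMoment α β 2 t / expMoment α β 0 t - tiltedMean α β t ^ 2) t := by
  have h0 := (expMoment_zero_pos hα hβ t).ne'
  refine ((hasDerivAt_expMoment hα hβ 1 t).div (hasDerivAt_expMoment hα hβ 0 t) h0).congr_deriv ?_
  rw [tiltedMean]
  field_simp

theorem deriv_tiltedMean_pos (hα : 0 < α) (hβ : 0 < β) (t : ℝ) :
    0 < deriv (tiltedMean α β) t := by
  have h0 := expMoment_zero_pos hα hβ t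
  rw [(hasDerivAt_tiltedMean hα hβ t).deriv, tiltedMean, div_pow, sub_pos,
    div_lt_div_iff₀ (by positivity) h0]
  nlinarith [mul_lt_mul_of_pos_right (expMoment_one_sq_lt hα hβ t) h0]

theorem differentiable_tiltedMean (hα : 0 < α) (hβ : 0 < β) :
    Differentiable ℝ (tiltedMean α β) :=
  fun t => (hasDerivAt_tiltedMean hα hβ t).differentiableAt

theorem strictMono_tiltedMean (hα : 0 < α) (hβ : 0 < β) : StrictMono (tiltedMean α β) :=
  strictMono_of_deriv_pos (deriv_tiltedMean_pos hα hβ)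

theorem tiltedMean_le_one (hα : 0 < α) (hβ : 0 < β) (t : ℝ) : tiltedMean α β t ≤ 1 :=
  div_le_one_of_le₀ (expMoment_one_le hα hβ t) (expMoment_zero_pos hα hβ t).le

theorem mean_lt_tiltedMean (hα : 0 < α) (hβ : 0 < β) {t : ℝ} (ht : 0 < t) :
    α / (α + β) < tiltedMean α β t := by
  simpa [tiltedMean_zero hα hβ] using strictMono_tiltedMean hα hβ ht

theorem deriv_tiltedMean_zero (hα : 0 < α) (hβ : 0 < β) :
    deriv (tiltedMean α β) 0 = betaVariance α β := by
  have hs : α + β ≠ 0 := by positivity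
  have hs1 : α + β + 1 ≠ 0 := by positivity
  rw [(hasDerivAt_tiltedMean hα hβ 0).deriv, tiltedMean_zero hα hβ, expMoment_zero_zero hα hβ,
    expMoment_succ hα hβ, expMoment_succ (by positivity) hβ,
    expMoment_zero_zero (by positivity) hβ, add_right_comm α 1 β, betaVariance]
  field_simp
  ring

theorem betaVariance_pos (hα : 0 < α) (hβ : 0 < β) : 0 < betaVariance α β :=
  deriv_tiltedMean_zero hα hβ ▸ deriv_tiltedMean_pos hα hβ 0

/-- The Riccati equation of the tilted mean, equivalent to Kummer's differential equation. -/
theorem riccati_tiltedMean (hα : 0 < α) (hβ : 0 < β) (t : ℝ) :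
    t * deriv (tiltedMean α β) t = t * (tiltedMean α β t * (1 - tiltedMean α β t))
      - (α + β) * (tiltedMean α β t - α / (α + β)) := by
  have h0 := (expMoment_zero_pos hα hβ t).ne'
  have hs : α + β ≠ 0 := by positivity
  rw [(hasDerivAt_tiltedMean hα hβ t).deriv, tiltedMean]
  field_simp
  linear_combination expMoment α β 0 t * kummer_ode hα hβ t

theorem slopeDefect_eq (hα : 0 < α) (hβ : 0 < β) (t : ℝ) :
    slopeDefect α β t = t * deriv (tiltedMean α β) t - (tiltedMean α β t - α / (α + β)) := by
  rw [riccati_tiltedMean hα hβ, slopeDefect]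
  ring

theorem hasDerivAt_criticalDefect (hα : 0 < α) (hβ : 0 < β) (t : ℝ) :
    HasDerivAt (criticalDefect α β) (slopeDefect α β t) t := by
  have hm := (differentiable_tiltedMean hα hβ t).hasDerivAt
  refine (((hasDerivAt_id t).mul (hm.sub_const (α / (α + β)))).sub
    ((hasDerivAt_centeredCgf hα hβ t).const_mul 2)).congr_deriv ?_
  rw [slopeDefect_eq hα hβ]
  simp only [id]
  ring

theorem continuous_criticalDefect (hα : 0 < α) (hβ : 0 < β) : Continuous (criticalDefect α β) :=
  continuous_iff_continuousAt.2 fun t => (hasDerivAt_criticalDefect hα hβ t).continuousAt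

theorem continuous_centeredCgf (hα : 0 < α) (hβ : 0 < β) : Continuous (centeredCgf α β) :=
  continuous_iff_continuousAt.2 fun t => (hasDerivAt_centeredCgf hα hβ t).continuousAt

theorem hasDerivAt_slopeDefect (hα : 0 < α) (hβ : 0 < β) (t : ℝ) :
    HasDerivAt (slopeDefect α β)
      (tiltedMean α β t * (1 - tiltedMean α β t)
        + t * (deriv (tiltedMean α β) t * (1 - 2 * tiltedMean α β t))
        - (α + β + 1) * deriv (tiltedMean α β) t) t := by
  have hm := (differentiable_tiltedMean hα hβ t).hasDerivAt
  refine (((hasDerivAt_id t).mul (hm.mul (hm.const_sub 1))).sub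
    ((hm.sub_const (α / (α + β))).const_mul (α + β + 1))).congr_deriv ?_
  simp only [id, Pi.mul_apply]
  ring

theorem continuous_slopeDefect (hα : 0 < α) (hβ : 0 < β) : Continuous (slopeDefect α β) :=
  continuous_iff_continuousAt.2 fun t => (hasDerivAt_slopeDefect hα hβ t).continuousAt

theorem tiltedSlope_zero (hα : 0 < α) (hβ : 0 < β) : tiltedSlope α β 0 = betaVariance α β := by
  rw [tiltedSlope, dslope_same, deriv_tiltedMean_zero hα hβ]

theorem tiltedSlope_of_ne (hα : 0 < α) (hβ : 0 < β) {t : ℝ} (ht : t ≠ 0) :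
    tiltedSlope α β t = (tiltedMean α β t - α / (α + β)) / t := by
  rw [tiltedSlope, dslope_of_ne _ ht, slope_def_field, sub_zero, tiltedMean_zero hα hβ]

theorem continuous_tiltedSlope (hα : 0 < α) (hβ : 0 < β) : Continuous (tiltedSlope α β) := by
  rw [← continuousOn_univ, tiltedSlope, continuousOn_dslope univ_mem]
  exact ⟨(differentiable_tiltedMean hα hβ).continuous.continuousOn,
    differentiable_tiltedMean hα hβ 0⟩

theorem deriv_tiltedSlope (hα : 0 < α) (hβ : 0 < β) {t : ℝ} (ht : t ≠ 0) :
    deriv (tiltedSlope α β) t = slopeDefect α β t / t ^ 2 := by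
  have hm := (differentiable_tiltedMean hα hβ t).hasDerivAt
  have e : tiltedSlope α β =ᶠ[𝓝 t] fun s => (tiltedMean α β s - α / (α + β)) / s := by
    filter_upwards [isOpen_ne.mem_nhds ht] with s hs using tiltedSlope_of_ne hα hβ hs
  rw [e.deriv_eq, ((hm.sub_const (α / (α + β))).fun_div (hasDerivAt_id' t) ht).deriv,
    slopeDefect_eq hα hβ]
  ring

/-! ### The integrating factor and the sign of the slope defect -/

/-- The slope defect times the integrating factor `t ^ (α + β) * M(t) ^ 2 * exp (-t)` of the linear
differential equation it satisfies on `t > 0`, where `M` is the moment generating function. -/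
noncomputable def weightedSlopeDefect (α β t : ℝ) : ℝ :=
  t ^ (α + β) * Real.exp (2 * centeredCgf α β t + (2 * (α / (α + β)) - 1) * t)
    * slopeDefect α β t

theorem hasDerivAt_weightedSlopeDefect (hα : 0 < α) (hβ : 0 < β) {t : ℝ} (ht : 0 < t) :
    HasDerivAt (weightedSlopeDefect α β)
      (t ^ (α + β) * Real.exp (2 * centeredCgf α β t + (2 * (α / (α + β)) - 1) * t)
        * (tiltedMean α β t - α / (α + β)) * (1 - 2 * tiltedMean α β t)) t := by
  have hp := Real.hasDerivAt_rpow_const (x := t) (p := α + β) (Or.inl ht.ne')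
  have he := (((hasDerivAt_centeredCgf hα hβ t).const_mul 2).add
    ((hasDerivAt_id t).const_mul (2 * (α / (α + β)) - 1))).exp
  refine ((hp.mul he).mul (hasDerivAt_slopeDefect hα hβ t)).congr_deriv ?_
  have hr := riccati_tiltedMean hα hβ t
  have hd : deriv (tiltedMean α β) t = tiltedMean α β t * (1 - tiltedMean α β t)
      - (α + β) * (tiltedMean α β t - α / (α + β)) / t := by
    field_simp at hr ⊢
    linarith
  rw [Real.rpow_sub_one ht.ne', hd, slopeDefect]
  simp only [Pi.add_apply, id, Pi.mul_apply]
  generalize Real.exp _ = E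
  generalize t ^ (α + β) = R
  generalize tiltedMean α β t = m
  generalize α / (α + β) = μ
  field_simp
  ring

theorem continuous_weightedSlopeDefect (hα : 0 < α) (hβ : 0 < β) :
    Continuous (weightedSlopeDefect α β) := by
  have h1 := continuous_centeredCgf hα hβ
  have h2 := continuous_slopeDefect hα hβ
  have h3 : Continuous fun t : ℝ => t ^ (α + β) := Real.continuous_rpow_const (by positivity)
  unfold weightedSlopeDefect
  fun_prop

theorem weightedSlopeDefect_zero (hα : 0 < α) (hβ : 0 < β) : weightedSlopeDefect α β 0 = 0 := by
  simp [weightedSlopeDefect, slopeDefect, tiltedMean_zero hα hβ]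

theorem weightedSlopeDefect_pos_iff {t : ℝ} (ht : 0 < t) :
    0 < weightedSlopeDefect α β t ↔ 0 < slopeDefect α β t :=
  mul_pos_iff_of_pos_left (by positivity)

theorem weightedSlopeDefect_neg_iff {t : ℝ} (ht : 0 < t) :
    weightedSlopeDefect α β t < 0 ↔ slopeDefect α β t < 0 := by
  rw [weightedSlopeDefect, ← neg_pos, ← mul_neg, mul_pos_iff_of_pos_left (by positivity), neg_pos]

/-- As long as the tilted mean stays below `1 / 2`, the slope defect is positive. -/
theorem slopeDefect_pos_of_tiltedMean_le (hα : 0 < α) (hβ : 0 < β) {t : ℝ} (ht : 0 < t)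
    (hm : tiltedMean α β t ≤ 1 / 2) : 0 < slopeDefect α β t := by
  rw [← weightedSlopeDefect_pos_iff ht, ← weightedSlopeDefect_zero hα hβ]
  refine strictMonoOn_of_deriv_pos (convex_Icc 0 t)
    (continuous_weightedSlopeDefect hα hβ).continuousOn (fun s hs => ?_)
    (Set.left_mem_Icc.2 ht.le) (Set.right_mem_Icc.2 ht.le) ht
  rw [interior_Icc] at hs
  have h1 := mean_lt_tiltedMean hα hβ hs.1
  have h2 := strictMono_tiltedMean hα hβ hs.2
  have h3 := hs.1
  rw [(hasDerivAt_weightedSlopeDefect hα hβ hs.1).deriv]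
  exact mul_pos (mul_pos (by positivity) (by linarith)) (by linarith)

/-- Once the tilted mean is above `1 / 2`, a nonpositive slope defect becomes negative for good. -/
theorem slopeDefect_neg_of_le_tiltedMean (hα : 0 < α) (hβ : 0 < β) {s t : ℝ} (hs : 0 ≤ s)
    (hst : s < t) (hm : 1 / 2 ≤ tiltedMean α β s) (h : weightedSlopeDefect α β s ≤ 0) :
    slopeDefect α β t < 0 := by
  rw [← weightedSlopeDefect_neg_iff (hs.trans_lt hst)]
  refine lt_of_lt_of_le ?_ h
  refine strictAntiOn_of_deriv_neg (convex_Icc s t)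
    (continuous_weightedSlopeDefect hα hβ).continuousOn (fun r hr => ?_)
    (Set.left_mem_Icc.2 hst.le) (Set.right_mem_Icc.2 hst.le) hst
  rw [interior_Icc] at hr
  have h0 : 0 < r := hs.trans_lt hr.1
  have h1 := mean_lt_tiltedMean hα hβ h0
  have h2 := strictMono_tiltedMean hα hβ hr.1
  rw [(hasDerivAt_weightedSlopeDefect hα hβ h0).deriv]
  exact mul_neg_of_pos_of_neg (mul_pos (by positivity) (by linarith)) (by linarith)

theorem slopeDefect_neg_of_nonpos (hα : 0 < α) (hβ : 0 < β) {s t : ℝ} (hs : 0 < s) (hst : s < t)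
    (h : slopeDefect α β s ≤ 0) : slopeDefect α β t < 0 := by
  refine slopeDefect_neg_of_le_tiltedMean hα hβ hs.le hst ?_ ?_
  · by_contra! hm
    exact h.not_gt (slopeDefect_pos_of_tiltedMean_le hα hβ hs hm.le)
  · rw [← not_lt, weightedSlopeDefect_pos_iff hs, not_lt]
    exact h

theorem slopeDefect_neg_of_le (hα : 0 < α) (hβ : 0 < β) (hαβ : β ≤ α) {t : ℝ} (ht : 0 < t) :
    slopeDefect α β t < 0 := by
  refine slopeDefect_neg_of_le_tiltedMean hα hβ le_rfl ht ?_ (weightedSlopeDefect_zero hα hβ).le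
  rw [tiltedMean_zero hα hβ, div_le_div_iff₀ (by positivity) (by positivity)]
  linarith

/-- The critical defect takes negative values: as the support of the law reaches up to `1`,
`centeredCgf α β t` grows like `(1 - α / (α + β)) * t`, so `criticalDefect α β t` behaves like
`-(1 - α / (α + β)) * t`. -/
theorem exists_criticalDefect_neg (hα : 0 < α) (hβ : 0 < β) :
    ∃ t, 0 < t ∧ criticalDefect α β t < 0 := by
  have := isProbabilityMeasureBeta hα hβ
  set μ := α / (α + β) with hμ
  have hμ0 : 0 < μ := by positivity
  have hμ1 : μ < 1 := by rw [hμ, div_lt_one (by positivity)]; linarith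
  -- Chernoff's bound at a level `a > (1 + μ) / 2` bounds the moment generating function below.
  set a := (3 + μ) / 4 with ha
  have hp := betaMeasure_Ici_pos hα hβ (a := a) (by positivity) (by linarith)
  set p := (betaMeasure α β).real (Set.Ici a)
  have hp1 : Real.log p ≤ 0 := Real.log_nonpos hp.le measureReal_le_one
  obtain ⟨t, ht⟩ := exists_gt (-4 * Real.log p / (1 - μ))
  have ht0 : 0 < t := lt_of_le_of_lt (div_nonneg (by linarith) (by linarith)) ht
  refine ⟨t, ht0, ?_⟩
  have hch : p ≤ Real.exp (-t * a) * expMoment α β 0 t := by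
    rw [← mgf_eq_expMoment]
    exact measure_ge_le_exp_mul_mgf a ht0.le (integrable_exp_betaMeasure hα hβ t)
  have hlog := Real.log_le_log hp hch
  rw [Real.log_mul (Real.exp_pos _).ne' (expMoment_zero_pos hα hβ t).ne', Real.log_exp] at hlog
  rw [div_lt_iff₀ (by linarith)] at ht
  have hm := mul_le_mul_of_nonneg_left (tiltedMean_le_one hα hβ t) ht0.le
  have ha' : t * a = t * (3 + μ) / 4 := by rw [ha]; ring
  rw [criticalDefect, centeredCgf, ← hμ]
  nlinarith

/-- For `α < β` the slope defect changes sign exactly once on `t > 0`, from plus to minus. -/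
theorem exists_slopeDefect_sign_change (hα : 0 < α) (hβ : 0 < β) (hαβ : α < β) :
    ∃ t₁, 0 < t₁ ∧ slopeDefect α β t₁ = 0 ∧ (∀ t ∈ Set.Ioo 0 t₁, 0 < slopeDefect α β t) ∧
      ∀ t, t₁ < t → slopeDefect α β t < 0 := by
  have hμ : tiltedMean α β 0 < 1 / 2 := by
    rw [tiltedMean_zero hα hβ, div_lt_div_iff₀ (by positivity) (by positivity)]
    linarith
  obtain ⟨a, ha0, ha⟩ : ∃ a, 0 < a ∧ 0 < slopeDefect α β a := by
    have hc := (differentiable_tiltedMean hα hβ).continuous.continuousAt (x := 0)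
    have hev : ∀ᶠ t in 𝓝[>] (0 : ℝ), tiltedMean α β t < 1 / 2 :=
      nhdsWithin_le_nhds (hc.eventually_lt_const hμ)
    obtain ⟨a, ha, ha0⟩ := (hev.and self_mem_nhdsWithin).exists
    exact ⟨a, ha0, slopeDefect_pos_of_tiltedMean_le hα hβ ha0 ha.le⟩
  obtain ⟨b, hb0, hb⟩ : ∃ b, 0 < b ∧ slopeDefect α β b < 0 := by
    by_contra! hN
    obtain ⟨t, ht0, ht⟩ := exists_criticalDefect_neg hα hβ
    refine ht.not_ge ?_
    rw [← criticalDefect_zero hα hβ]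
    refine monotoneOn_of_deriv_nonneg (convex_Icc 0 t)
      (continuous_criticalDefect hα hβ).continuousOn
      (fun s _ => (hasDerivAt_criticalDefect hα hβ s).differentiableAt.differentiableWithinAt)
      (fun s hs => ?_) (Set.left_mem_Icc.2 ht0.le) (Set.right_mem_Icc.2 ht0.le) ht0.le
    rw [interior_Icc] at hs
    rw [(hasDerivAt_criticalDefect hα hβ s).deriv]
    exact hN s hs.1
  have hab : a ≤ b := by
    by_contra! h
    exact ha.not_gt (slopeDefect_neg_of_nonpos hα hβ hb0 h hb.le)
  obtain ⟨t₁, ht₁, h₁⟩ := intermediate_value_Icc' hab (continuous_slopeDefect hα hβ).continuousOn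
    ⟨hb.le, ha.le⟩
  have ht₁0 : 0 < t₁ := ha0.trans_le ht₁.1
  refine ⟨t₁, ht₁0, h₁, fun t ht => ?_, fun t ht => slopeDefect_neg_of_nonpos hα hβ ht₁0 ht h₁.le⟩
  by_contra! h
  exact (slopeDefect_neg_of_nonpos hα hβ ht.1 ht.2 h).ne h₁

end BetaProxy

namespace BetaProxy

variable {α β : ℝ}

/-! ### Maximizing the ratio of the centred cumulant generating function to `t ^ 2 / 2` -/

/-- For `β ≤ α`, the variance is a proxy variance as far as positive arguments are concerned. -/
theorem centeredCgf_le_of_le (hα : 0 < α) (hβ : 0 < β) (hαβ : β ≤ α) {t : ℝ} (ht : 0 < t) :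
    centeredCgf α β t ≤ betaVariance α β * t ^ 2 / 2 := by
  have hanti : StrictAntiOn (tiltedSlope α β) (Set.Ici 0) := by
    refine strictAntiOn_of_deriv_neg (convex_Ici 0) (continuous_tiltedSlope hα hβ).continuousOn
      fun s hs => ?_
    rw [interior_Ici] at hs
    have hs0 : 0 < s := hs
    rw [deriv_tiltedSlope hα hβ hs0.ne']
    exact div_neg_of_neg_of_pos (slopeDefect_neg_of_le hα hβ hαβ hs0) (by positivity)
  have hd (s : ℝ) : HasDerivAt (fun s => betaVariance α β * s ^ 2 / 2 - centeredCgf α β s)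
      (betaVariance α β * s - (tiltedMean α β s - α / (α + β))) s := by
    refine ((((hasDerivAt_pow 2 s).const_mul (betaVariance α β)).div_const 2).sub
      (hasDerivAt_centeredCgf hα hβ s)).congr_deriv ?_
    push_cast
    ring
  have hmono : MonotoneOn (fun s => betaVariance α β * s ^ 2 / 2 - centeredCgf α β s)
      (Set.Ici 0) := by
    refine monotoneOn_of_deriv_nonneg (convex_Ici 0)
      (fun s _ => (hd s).continuousAt.continuousWithinAt)
      (fun s _ => (hd s).differentiableAt.differentiableWithinAt) fun s hs => ?_
    rw [interior_Ici] at hs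
    have hs0 : 0 < s := hs
    have h := hanti Set.self_mem_Ici hs0.le hs0
    rw [tiltedSlope_zero hα hβ, tiltedSlope_of_ne hα hβ hs0.ne', div_lt_iff₀ hs0] at h
    rw [(hd s).deriv]
    linarith
  have h := hmono Set.self_mem_Ici ht.le ht.le
  simp only [centeredCgf_zero hα hβ] at h
  linarith

/-- For `β ≤ α` the equation for the critical points has no positive solution. -/
theorem criticalDefect_neg_of_le (hα : 0 < α) (hβ : 0 < β) (hαβ : β ≤ α) {t : ℝ} (ht : 0 < t) :
    criticalDefect α β t < 0 := by
  rw [← criticalDefect_zero hα hβ]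
  refine strictAntiOn_of_deriv_neg (convex_Ici 0) (continuous_criticalDefect hα hβ).continuousOn
    (fun s hs => ?_) Set.self_mem_Ici ht.le ht
  rw [interior_Ici] at hs
  rw [(hasDerivAt_criticalDefect hα hβ s).deriv]
  exact slopeDefect_neg_of_le hα hβ hαβ hs

theorem lt_centeredCgf_of_lt_tiltedSlope (hα : 0 < α) (hβ : 0 < β) {s b : ℝ} (hb : 0 < b)
    (h : ∀ t ∈ Set.Ioo 0 b, s < tiltedSlope α β t) : s * b ^ 2 / 2 < centeredCgf α β b := by
  have hd (t : ℝ) : HasDerivAt (fun t => centeredCgf α β t - s * t ^ 2 / 2)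
      (tiltedMean α β t - α / (α + β) - s * t) t := by
    refine ((hasDerivAt_centeredCgf hα hβ t).sub
      (((hasDerivAt_pow 2 t).const_mul s).div_const 2)).congr_deriv ?_
    push_cast
    ring
  have hmono : StrictMonoOn (fun t => centeredCgf α β t - s * t ^ 2 / 2) (Set.Icc 0 b) := by
    refine strictMonoOn_of_deriv_pos (convex_Icc 0 b)
      (fun t _ => (hd t).continuousAt.continuousWithinAt) fun t ht => ?_
    rw [interior_Icc] at ht
    have h' := h t ht
    rw [tiltedSlope_of_ne hα hβ ht.1.ne', lt_div_iff₀ ht.1] at h'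
    rw [(hd t).deriv]
    linarith
  have := hmono (Set.left_mem_Icc.2 hb.le) (Set.right_mem_Icc.2 hb.le) hb
  simp only [centeredCgf_zero hα hβ] at this
  linarith

/-- Every proxy variance is at least the variance. -/
theorem betaVariance_le_of_centeredCgf_le (hα : 0 < α) (hβ : 0 < β) {s : ℝ}
    (h : ∀ t, centeredCgf α β t ≤ s * t ^ 2 / 2) : betaVariance α β ≤ s := by
  by_contra! hs
  rw [← tiltedSlope_zero hα hβ] at hs
  have hev := (continuous_tiltedSlope hα hβ).continuousAt.eventually_const_lt hs
  obtain ⟨b, hb, hsub⟩ := Metric.eventually_nhds_iff.1 hev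
  refine (h b).not_gt (lt_centeredCgf_of_lt_tiltedSlope hα hβ hb fun t ht => hsub ?_)
  rw [Real.dist_eq, sub_zero, abs_of_pos ht.1]
  exact ht.2

theorem hasDerivAt_centeredCgf_ratio (hα : 0 < α) (hβ : 0 < β) {t : ℝ} (ht : t ≠ 0) :
    HasDerivAt (fun t => 2 * centeredCgf α β t / t ^ 2) (2 * criticalDefect α β t / t ^ 3) t := by
  refine (((hasDerivAt_centeredCgf hα hβ t).const_mul 2).fun_div (hasDerivAt_pow 2 t)
    (pow_ne_zero 2 ht)).congr_deriv ?_
  rw [criticalDefect]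
  field_simp
  ring

/-- The positive half-line in the case `α < β`: the critical defect has exactly one zero `x₀`, where
the ratio of `centeredCgf` to `t ^ 2 / 2` is maximal, with maximum `tiltedSlope α β x₀`. -/
theorem exists_pos_maximizer (hα : 0 < α) (hβ : 0 < β) (hαβ : α < β) :
    ∃ x₀, 0 < x₀ ∧ criticalDefect α β x₀ = 0 ∧
      (∀ t, 0 < t → criticalDefect α β t = 0 → t = x₀) ∧
      (∀ t, 0 < t → centeredCgf α β t ≤ tiltedSlope α β x₀ * t ^ 2 / 2) ∧
      betaVariance α β < tiltedSlope α β x₀ ∧ tiltedSlope α β x₀ < 1 / (4 * (α + β + 1)) := by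
  obtain ⟨t₁, ht₁, h₁, hpos, hneg⟩ := exists_slopeDefect_sign_change hα hβ hαβ
  have hcD := continuous_criticalDefect hα hβ
  have hcV := continuous_tiltedSlope hα hβ
  have hDmono : StrictMonoOn (criticalDefect α β) (Set.Icc 0 t₁) := by
    refine strictMonoOn_of_deriv_pos (convex_Icc 0 t₁) hcD.continuousOn fun s hs => ?_
    rw [interior_Icc] at hs
    rw [(hasDerivAt_criticalDefect hα hβ s).deriv]
    exact hpos s hs
  have hDanti : StrictAntiOn (criticalDefect α β) (Set.Ici t₁) := by
    refine strictAntiOn_of_deriv_neg (convex_Ici t₁) hcD.continuousOn fun s hs => ?_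
    rw [interior_Ici] at hs
    rw [(hasDerivAt_criticalDefect hα hβ s).deriv]
    exact hneg s hs
  have hVmono : StrictMonoOn (tiltedSlope α β) (Set.Icc 0 t₁) := by
    refine strictMonoOn_of_deriv_pos (convex_Icc 0 t₁) hcV.continuousOn fun s hs => ?_
    rw [interior_Icc] at hs
    rw [deriv_tiltedSlope hα hβ hs.1.ne']
    exact div_pos (hpos s hs) (pow_pos hs.1 2)
  have hVanti : StrictAntiOn (tiltedSlope α β) (Set.Ici t₁) := by
    refine strictAntiOn_of_deriv_neg (convex_Ici t₁) hcV.continuousOn fun s hs => ?_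
    rw [interior_Ici] at hs
    have hs0 : 0 < s := ht₁.trans hs
    rw [deriv_tiltedSlope hα hβ hs0.ne']
    exact div_neg_of_neg_of_pos (hneg s hs) (pow_pos hs0 2)
  have hDpos (t : ℝ) (ht : 0 < t) (htt : t ≤ t₁) : 0 < criticalDefect α β t := by
    rw [← criticalDefect_zero hα hβ]
    exact hDmono (Set.left_mem_Icc.2 ht₁.le) ⟨ht.le, htt⟩ ht
  obtain ⟨b, hb0, hb⟩ := exists_criticalDefect_neg hα hβ
  have hb₁ : t₁ ≤ b := by
    by_contra! h
    exact hb.not_gt (hDpos b hb0 h.le)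
  obtain ⟨x₀, hx, hx₀⟩ := intermediate_value_Icc' hb₁ hcD.continuousOn
    ⟨hb.le, (hDpos t₁ ht₁ le_rfl).le⟩
  have hx₁ : t₁ < x₀ := by
    refine lt_of_le_of_ne hx.1 ?_
    rintro rfl
    exact (hDpos t₁ ht₁ le_rfl).ne' hx₀
  have hx0 : 0 < x₀ := ht₁.trans hx₁
  have hleft (t : ℝ) (ht : 0 < t) (htx : t < x₀) : 0 < criticalDefect α β t := by
    rcases le_or_gt t t₁ with h | h
    · exact hDpos t ht h
    · rw [← hx₀]
      exact hDanti h.le hx₁.le htx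
  have hright (t : ℝ) (ht : x₀ < t) : criticalDefect α β t < 0 := by
    rw [← hx₀]
    exact hDanti hx₁.le (hx₁.trans ht).le ht
  have hval : 2 * centeredCgf α β x₀ / x₀ ^ 2 = tiltedSlope α β x₀ := by
    rw [tiltedSlope_of_ne hα hβ hx0.ne']
    rw [criticalDefect, sub_eq_zero] at hx₀
    rw [← hx₀]
    field_simp
  have hd {t : ℝ} (ht : 0 < t) := hasDerivAt_centeredCgf_ratio hα hβ ht.ne'
  have hratio (t : ℝ) (ht : 0 < t) : 2 * centeredCgf α β t / t ^ 2 ≤ tiltedSlope α β x₀ := by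
    rw [← hval]
    rcases le_total t x₀ with h | h
    · refine monotoneOn_of_deriv_nonneg (convex_Icc t x₀)
        (fun s hs => (hd (ht.trans_le hs.1)).continuousAt.continuousWithinAt)
        (fun s hs => ?_) (fun s hs => ?_) (Set.left_mem_Icc.2 h) (Set.right_mem_Icc.2 h) h
      · rw [interior_Icc] at hs
        exact (hd (ht.trans hs.1)).differentiableAt.differentiableWithinAt
      · rw [interior_Icc] at hs
        have hs0 := ht.trans hs.1
        have := hleft s hs0 hs.2
        rw [(hd hs0).deriv]
        positivity
    · refine antitoneOn_of_deriv_nonpos (convex_Icc x₀ t)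
        (fun s hs => (hd (hx0.trans_le hs.1)).continuousAt.continuousWithinAt)
        (fun s hs => ?_) (fun s hs => ?_) (Set.left_mem_Icc.2 h) (Set.right_mem_Icc.2 h) h
      · rw [interior_Icc] at hs
        exact (hd (hx0.trans hs.1)).differentiableAt.differentiableWithinAt
      · rw [interior_Icc] at hs
        have hs0 := hx0.trans hs.1
        have := hright s hs.1
        rw [(hd hs0).deriv]
        exact div_nonpos_of_nonpos_of_nonneg (by linarith) (by positivity)
  refine ⟨x₀, hx0, hx₀, fun t ht h => ?_, fun t ht => ?_, ?_, ?_⟩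
  · rcases lt_trichotomy t x₀ with h' | h' | h'
    · exact absurd h (hleft t ht h').ne'
    · exact h'
    · exact absurd h (hright t h').ne
  · have := hratio t ht
    rw [div_le_iff₀ (by positivity)] at this
    linarith
  · -- On `(0, t₁]` the slope exceeds its value at `0`, hence so does its weighted average.
    refine lt_of_lt_of_le ?_ (hratio t₁ ht₁)
    have := lt_centeredCgf_of_lt_tiltedSlope hα hβ (s := betaVariance α β) ht₁ fun t ht => by
      rw [← tiltedSlope_zero hα hβ]
      exact hVmono (Set.left_mem_Icc.2 ht₁.le) (Set.Ioo_subset_Icc_self ht) ht.1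
    rw [lt_div_iff₀ (by positivity)]
    linarith
  · -- The maximum of the slope is at `t₁`, where it is `m (1 - m) / (α + β + 1)`.
    refine (hVanti Set.self_mem_Ici hx₁.le hx₁).trans_le ?_
    rw [tiltedSlope_of_ne hα hβ ht₁.ne', div_le_div_iff₀ ht₁ (by positivity)]
    rw [slopeDefect] at h₁
    nlinarith [mul_nonneg ht₁.le (sq_nonneg (2 * tiltedMean α β t₁ - 1))]

/-! ### Reflection -/

theorem mean_swap (hα : 0 < α) (hβ : 0 < β) : β / (β + α) = 1 - α / (α + β) := by
  have h1 : α + β ≠ 0 := by positivity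
  have h2 : β + α ≠ 0 := by positivity
  field_simp
  ring

theorem centeredCgf_neg (hα : 0 < α) (hβ : 0 < β) (t : ℝ) :
    centeredCgf α β (-t) = centeredCgf β α t := by
  rw [centeredCgf, centeredCgf, expMoment_swap hα hβ,
    Real.log_mul (Real.exp_pos t).ne' (expMoment_zero_pos hα hβ (-t)).ne', Real.log_exp,
    mean_swap hα hβ]
  ring

theorem tiltedMean_neg (hα : 0 < α) (hβ : 0 < β) (t : ℝ) :
    tiltedMean α β (-t) = 1 - tiltedMean β α t := by
  have h1 := hasDerivAt_centeredCgf hβ hα t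
  have h2 := (hasDerivAt_centeredCgf hα hβ (-t)).comp t (hasDerivAt_neg t)
  have e : centeredCgf β α = centeredCgf α β ∘ Neg.neg :=
    funext fun s => (centeredCgf_neg hα hβ s).symm
  rw [e, mean_swap hα hβ] at h1
  linarith [h1.unique h2]

theorem criticalDefect_neg_arg (hα : 0 < α) (hβ : 0 < β) (t : ℝ) :
    criticalDefect α β (-t) = criticalDefect β α t := by
  rw [criticalDefect, criticalDefect, centeredCgf_neg hα hβ, tiltedMean_neg hα hβ, mean_swap hα hβ]
  ring

theorem betaVariance_swap (hα : 0 < α) (hβ : 0 < β) : betaVariance β α = betaVariance α β := by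
  rw [betaVariance, betaVariance, mean_swap hα hβ, add_comm β α]
  ring

theorem tiltedSlope_neg (hα : 0 < α) (hβ : 0 < β) (t : ℝ) :
    tiltedSlope α β (-t) = tiltedSlope β α t := by
  rcases eq_or_ne t 0 with rfl | ht
  · rw [neg_zero, tiltedSlope_zero hα hβ, tiltedSlope_zero hβ hα, betaVariance_swap hα hβ]
  · rw [tiltedSlope_of_ne hα hβ (neg_ne_zero.2 ht), tiltedSlope_of_ne hβ hα ht,
      tiltedMean_neg hα hβ, mean_swap hα hβ, div_neg, ← neg_div]
    ring

theorem exists_maximizer_of_lt (hα : 0 < α) (hβ : 0 < β) (hαβ : α < β) :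
    ∃ x₀, x₀ ≠ 0 ∧ criticalDefect α β x₀ = 0 ∧
      (∀ t, t ≠ 0 → criticalDefect α β t = 0 → t = x₀) ∧
      (∀ t, centeredCgf α β t ≤ tiltedSlope α β x₀ * t ^ 2 / 2) ∧
      betaVariance α β < tiltedSlope α β x₀ ∧ tiltedSlope α β x₀ < 1 / (4 * (α + β + 1)) := by
  obtain ⟨x₀, hx0, hx₀, huniq, hle, hvar, hupper⟩ := exists_pos_maximizer hα hβ hαβ
  refine ⟨x₀, hx0.ne', hx₀, fun t ht h => ?_, fun t => ?_, hvar, hupper⟩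
  · rcases lt_or_gt_of_ne ht with ht | ht
    · have h' := criticalDefect_neg_of_le hβ hα hαβ.le (neg_pos.2 ht)
      rw [← criticalDefect_neg_arg hα hβ, neg_neg] at h'
      exact absurd h h'.ne
    · exact huniq t ht h
  · rcases lt_trichotomy t 0 with ht | rfl | ht
    · have h' := centeredCgf_le_of_le hβ hα hαβ.le (neg_pos.2 ht)
      rw [← centeredCgf_neg hα hβ, neg_neg, betaVariance_swap hα hβ, neg_sq] at h'
      refine h'.trans ?_
      gcongr
    · simp [centeredCgf_zero hα hβ]
    · exact hle t ht

/-- For `α ≠ β` the critical defect has exactly one nonzero zero, and the ratio of `centeredCgf` to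
`t ^ 2 / 2` is maximal there. -/
theorem exists_maximizer (hα : 0 < α) (hβ : 0 < β) (hαβ : α ≠ β) :
    ∃ x₀, x₀ ≠ 0 ∧ criticalDefect α β x₀ = 0 ∧
      (∀ t, t ≠ 0 → criticalDefect α β t = 0 → t = x₀) ∧
      (∀ t, centeredCgf α β t ≤ tiltedSlope α β x₀ * t ^ 2 / 2) ∧
      betaVariance α β < tiltedSlope α β x₀ ∧ tiltedSlope α β x₀ < 1 / (4 * (α + β + 1)) := by
  rcases lt_or_gt_of_ne hαβ with h | h
  · exact exists_maximizer_of_lt hα hβ h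
  · obtain ⟨x₀, hx0, hx₀, huniq, hle, hvar, hupper⟩ := exists_maximizer_of_lt hβ hα h
    refine ⟨-x₀, neg_ne_zero.2 hx0, ?_, fun t ht h0 => ?_, fun t => ?_, ?_, ?_⟩
    · rw [criticalDefect_neg_arg hα hβ, hx₀]
    · rw [← huniq (-t) (neg_ne_zero.2 ht) (by rw [criticalDefect_neg_arg hβ hα, h0]), neg_neg]
    · rw [tiltedSlope_neg hα hβ, ← neg_sq t, ← centeredCgf_neg hβ hα]
      exact hle (-t)
    · rw [tiltedSlope_neg hα hβ, ← betaVariance_swap hα hβ]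
      exact hvar
    · rw [tiltedSlope_neg hα hβ, add_comm α β]
      exact hupper

/-- In the symmetric case the variance itself is a proxy variance. -/
theorem centeredCgf_le_of_symm (hα : 0 < α) (t : ℝ) :
    centeredCgf α α t ≤ betaVariance α α * t ^ 2 / 2 := by
  rcases lt_trichotomy t 0 with ht | rfl | ht
  · rw [← neg_sq t, ← neg_neg t, centeredCgf_neg hα hα, neg_neg]
    exact centeredCgf_le_of_le hα hα le_rfl (neg_pos.2 ht)
  · simp [centeredCgf_zero hα hα]
  · exact centeredCgf_le_of_le hα hα le_rfl ht

theorem criticalDefect_eq_zero_iff_of_symm (hα : 0 < α) (t : ℝ) :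
    criticalDefect α α t = 0 ↔ t = 0 := by
  refine ⟨fun h => ?_, fun h => by rw [h, criticalDefect_zero hα hα]⟩
  rcases lt_trichotomy t 0 with ht | ht | ht
  · rw [← neg_neg t, criticalDefect_neg_arg hα hα] at h
    exact absurd h (criticalDefect_neg_of_le hα hα le_rfl (neg_pos.2 ht)).ne
  · exact ht
  · exact absurd h (criticalDefect_neg_of_le hα hα le_rfl ht).ne

/-! ### Translation to Kummer's function and to proxy variances -/

theorem kummerEquation_iff (hα : 0 < α) (hβ : 0 < β) (x : ℝ) :
    KummerEquation α β x ↔ criticalDefect α β x = 0 := by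
  have e : α * x / (2 * (α + β)) *
      (1 + kummer (α + 1) (α + β + 1) x / kummer α (α + β) x) =
      x * (α / (α + β) + tiltedMean α β x) / 2 := by
    have hs : α + β ≠ 0 := by positivity
    have h0 := (expMoment_zero_pos hα hβ x).ne'
    rw [tiltedMean, ← kummer_add_one_eq_expMoment hα hβ, kummer_eq_expMoment hα hβ]
    field_simp
  rw [KummerEquation, e, kummer_eq_expMoment hα hβ, criticalDefect, centeredCgf]
  constructor <;> intro h <;> linarith

theorem kummerVariance_eq (hα : 0 < α) (hβ : 0 < β) {x : ℝ} (hx : x ≠ 0) :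
    kummerVariance α β x = tiltedSlope α β x := by
  have hs : α + β ≠ 0 := by positivity
  have h0 := (expMoment_zero_pos hα hβ x).ne'
  rw [kummerVariance, tiltedSlope_of_ne hα hβ hx, tiltedMean, ← kummer_add_one_eq_expMoment hα hβ,
    kummer_eq_expMoment hα hβ]
  field_simp

theorem integral_id_betaMeasure (hα : 0 < α) (hβ : 0 < β) :
    ∫ x, x ∂betaMeasure α β = α / (α + β) := by
  have h := expMoment_succ hα hβ 0 0
  rw [expMoment_zero_zero (by positivity) hβ, mul_one] at h
  simpa [expMoment] using h

theorem variance_id_betaMeasure (hα : 0 < α) (hβ : 0 < β) :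
    variance (fun x : ℝ => x) (betaMeasure α β) = betaVariance α β := by
  have := isProbabilityMeasureBeta hα hβ
  rw [variance_eq_sub (memLp_of_mem_interior_integrableExpSet
    (mem_interior_integrableExpSet hα hβ 0) 2), integral_id_betaMeasure hα hβ,
    ← deriv_tiltedMean_zero hα hβ, (hasDerivAt_tiltedMean hα hβ 0).deriv, tiltedMean_zero hα hβ,
    expMoment_zero_zero hα hβ, div_one]
  simp [expMoment]

theorem isSubGaussian_iff (hα : 0 < α) (hβ : 0 < β) (s : NNReal) :
    IsSubGaussian (fun x : ℝ => x) (betaMeasure α β) s ↔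
      ∀ t, centeredCgf α β t ≤ s * t ^ 2 / 2 := by
  have := isProbabilityMeasureBeta hα hβ
  have key (t : ℝ) : mgf (fun x : ℝ => x - ∫ y, y ∂betaMeasure α β) (betaMeasure α β) t =
      Real.exp (centeredCgf α β t) := by
    simp only [sub_eq_add_neg]
    rw [integral_id_betaMeasure hα hβ, mgf_add_const, mgf_eq_expMoment, centeredCgf,
      sub_eq_add_neg, Real.exp_add, Real.exp_log (expMoment_zero_pos hα hβ t), mul_comm t, neg_mul]
  constructor
  · rintro ⟨-, h⟩ t
    have := h.mgf_le t
    rwa [key, Real.exp_le_exp] at this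
  · refine fun h => ⟨?_, fun t => ?_, fun t => ?_⟩
    · simpa using integrable_pow_mul_exp hα hβ 1 0
    · have e : (fun x : ℝ => Real.exp (t * (x - ∫ y, y ∂betaMeasure α β))) =
          fun x => Real.exp (t * x) * Real.exp (-(t * ∫ y, y ∂betaMeasure α β)) := by
        ext x
        rw [← Real.exp_add]
        ring_nf
      rw [e]
      exact (integrable_exp_betaMeasure hα hβ t).mul_const _
    · rw [key, Real.exp_le_exp]
      exact h t

/-- A least real bound for the ratio of `centeredCgf` to `t ^ 2 / 2` is the optimal proxy variance,
and the infimum is attained. -/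
theorem optimalProxyVariance_eq (hα : 0 < α) (hβ : 0 < β) {s : ℝ} (hs : 0 ≤ s)
    (h : ∀ t, centeredCgf α β t ≤ s * t ^ 2 / 2)
    (hmin : ∀ r, (∀ t, centeredCgf α β t ≤ r * t ^ 2 / 2) → s ≤ r) :
    IsLeast {s : NNReal | IsSubGaussian (fun x : ℝ => x) (betaMeasure α β) s}
      (optimalProxyVariance (fun x : ℝ => x) (betaMeasure α β)) ∧
    (optimalProxyVariance (fun x : ℝ => x) (betaMeasure α β) : ℝ) = s := by
  have hl : IsLeast {s : NNReal | IsSubGaussian (fun x : ℝ => x) (betaMeasure α β) s}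
      ⟨s, hs⟩ :=
    ⟨(isSubGaussian_iff hα hβ _).2 h, fun r hr => hmin r ((isSubGaussian_iff hα hβ r).1 hr)⟩
  have e : optimalProxyVariance (fun x : ℝ => x) (betaMeasure α β) = ⟨s, hs⟩ := hl.csInf_eq
  rw [e]
  exact ⟨hl, rfl⟩

end BetaProxy

theorem theorem1 (α β : ℝ) (hα : 0 < α) (hβ : 0 < β) :
    -- the infimum defining the optimal proxy variance is attained: it is itself a proxy variance
    IsLeast {s : NNReal | BetaProxy.IsSubGaussian (fun x : ℝ => x) (betaMeasure α β) s}
      (BetaProxy.optimalProxyVariance (fun x : ℝ => x) (betaMeasure α β)) ∧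
    -- the value of the optimal proxy variance
    (α ≠ β →
      ∃ x₀ : ℝ, x₀ ≠ 0 ∧ BetaProxy.KummerEquation α β x₀ ∧
        (∀ x : ℝ, x ≠ 0 → BetaProxy.KummerEquation α β x → x = x₀) ∧
        (BetaProxy.optimalProxyVariance (fun x : ℝ => x) (betaMeasure α β) : ℝ) =
          BetaProxy.kummerVariance α β x₀) ∧
    -- in the symmetric case the unique solution is `0` and the formula is read as a limit
    (α = β →
      (∀ x : ℝ, BetaProxy.KummerEquation α β x ↔ x = 0) ∧
      Tendsto (BetaProxy.kummerVariance α β) (𝓝[≠] 0)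
        (𝓝 (BetaProxy.optimalProxyVariance (fun x : ℝ => x) (betaMeasure α β) : ℝ))) ∧
    -- comparison with the variance and with the explicit upper bound
    (α ≠ β →
      variance (fun x : ℝ => x) (betaMeasure α β) <
          (BetaProxy.optimalProxyVariance (fun x : ℝ => x) (betaMeasure α β) : ℝ) ∧
        (BetaProxy.optimalProxyVariance (fun x : ℝ => x) (betaMeasure α β) : ℝ) <
          1 / (4 * (α + β + 1))) ∧
    (α = β →
      variance (fun x : ℝ => x) (betaMeasure α β) =
          (BetaProxy.optimalProxyVariance (fun x : ℝ => x) (betaMeasure α β) : ℝ) ∧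
        (BetaProxy.optimalProxyVariance (fun x : ℝ => x) (betaMeasure α β) : ℝ) =
          1 / (4 * (2 * α + 1))) := by
  rcases ne_or_eq α β with hne | rfl
  · obtain ⟨x₀, hx0, hx₀, huniq, hle, hvar, hupper⟩ := BetaProxy.exists_maximizer hα hβ hne
    have hs : 0 ≤ BetaProxy.tiltedSlope α β x₀ :=
      (BetaProxy.betaVariance_pos hα hβ).le.trans hvar.le
    obtain ⟨hleast, hopt⟩ := BetaProxy.optimalProxyVariance_eq hα hβ hs hle fun r hr => by
      -- At the zero `x₀` of the critical defect the bound `hle` is an equality.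
      have h := hr x₀
      have hv := BetaProxy.tiltedSlope_of_ne hα hβ hx0
      rw [eq_div_iff hx0] at hv
      rw [BetaProxy.criticalDefect, ← hv, sub_eq_zero] at hx₀
      have hsq : 0 < x₀ ^ 2 := by positivity
      refine le_of_mul_le_mul_right ?_ hsq
      linarith
    refine ⟨hleast, fun _ => ⟨x₀, hx0, (BetaProxy.kummerEquation_iff hα hβ x₀).2 hx₀,
      fun x hx h => huniq x hx ((BetaProxy.kummerEquation_iff hα hβ x).1 h), ?_⟩,
      fun h => absurd h hne, fun _ => ?_, fun h => absurd h hne⟩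
    · rw [hopt, BetaProxy.kummerVariance_eq hα hβ hx0]
    · rw [hopt, BetaProxy.variance_id_betaMeasure hα hβ]
      exact ⟨hvar, hupper⟩
  · obtain ⟨hleast, hopt⟩ := BetaProxy.optimalProxyVariance_eq hα hα
      (BetaProxy.betaVariance_pos hα hα).le (BetaProxy.centeredCgf_le_of_symm hα)
      fun r hr => BetaProxy.betaVariance_le_of_centeredCgf_le hα hα hr
    refine ⟨hleast, fun h => absurd rfl h, fun _ => ⟨fun x => ?_, ?_⟩, fun h => absurd rfl h,
      fun _ => ⟨?_, ?_⟩⟩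
    · rw [BetaProxy.kummerEquation_iff hα hα, BetaProxy.criticalDefect_eq_zero_iff_of_symm hα]
    · rw [hopt, ← BetaProxy.tiltedSlope_zero hα hα]
      refine ((BetaProxy.continuous_tiltedSlope hα hα).tendsto 0).mono_left
        nhdsWithin_le_nhds |>.congr' ?_
      filter_upwards [self_mem_nhdsWithin] with x hx
      exact (BetaProxy.kummerVariance_eq hα hα hx).symm
    · rw [hopt, BetaProxy.variance_id_betaMeasure hα hα]
    · rw [hopt, BetaProxy.betaVariance, ← two_mul]
      have h1 : 2 * α + 1 ≠ 0 := by positivity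
      field_simp
      norm_num
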